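/- Let $(R,\mathfrak m)$ be a noetherian local ring. For a finitely generated $R$-module $M$ let $F$ be the minimal free resolution of $M$, filtered by $(\mathcal G^nF)_i=\mathfrak m^{n-i}F_i$ (where $\mathfrak m^j=R$ for $j\le 0$). The linear part $\operatorname{lin}^R F$ is the associated graded complex $\bigoplus_n \mathcal G^nF/\mathcal G^{n+1}F$, and the linearity defect of $M$ is $$\operatorname{ld}_R M=\sup\{i : H_i(\operatorname{lin}^R F)\neq 0\},$$ with $\operatorname{ld}_R 0=0$. A noetherian local ring $R$ is called absolutely Koszul if $\operatorname{ld}_R M<\infty$ for every finitely generated $R$-module $M$. Let $(R,\mathfrak m)$ be an absolutely Koszul (noetherian) local ring, and let $x\in\mathfrak m\setminus\mathfrak m^2$ be an element whose class $\overline x\in\mathfrak m/\mathfrak m^2$ is a non-zero-divisor on the associated graded ring $\operatorname{gr}_{\mathfrak m}R=\bigoplus_{n\ge 0}\mathfrak m^n/\mathfrak m^{n+1}$. Then $R/(x)$ is a (noetherian) local ring which is again absolutely Koszul. -/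

import Mathlib

open scoped DirectSum

universe u v

section AssociatedGraded

variable {R : Type u} [CommRing R] (I : Ideal R)

/-- The degree `n` piece `Iⁿ / Iⁿ⁺¹` of the associated graded ring of the ideal `I`. -/
abbrev Ideal.GrPiece (n : ℕ) : Type u :=
  ↥(I ^ n) ⧸ (I ^ (n + 1)).submoduleOf (I ^ n)

/-- The class in `Iⁿ / Iⁿ⁺¹` of an element `a` of `Iⁿ`. -/
def Ideal.grMk (n : ℕ) (a : R) (ha : a ∈ I ^ n) : I.GrPiece n :=
  Submodule.Quotient.mk ⟨a, ha⟩

namespace Ideal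

variable {I}

theorem grMk_eq_grMk {n : ℕ} {a b : R} {ha : a ∈ I ^ n} {hb : b ∈ I ^ n} :
    I.grMk n a ha = I.grMk n b hb ↔ a - b ∈ I ^ (n + 1) :=
  Submodule.Quotient.eq _

theorem exists_grMk {n : ℕ} (q : I.GrPiece n) : ∃ a ha, I.grMk n a ha = q := by
  obtain ⟨⟨a, ha⟩, rfl⟩ := Submodule.Quotient.mk_surjective _ q
  exact ⟨a, ha, rfl⟩

theorem mul_mem_pow_add {i j : ℕ} {a b : R} (ha : a ∈ I ^ i) (hb : b ∈ I ^ j) :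
    a * b ∈ I ^ (i + j) := by
  rw [pow_add]
  exact Ideal.mul_mem_mul ha hb

/-- Multiplication `Iⁱ / Iⁱ⁺¹ × Iʲ / Iʲ⁺¹ → Iⁱ⁺ʲ / Iⁱ⁺ʲ⁺¹`, induced by that of `R`. -/
def grMul {i j : ℕ} : I.GrPiece i → I.GrPiece j → I.GrPiece (i + j) :=
  Quotient.map₂ (fun a b => ⟨(a : R) * b, mul_mem_pow_add a.2 b.2⟩) (by
    intro a a' h b b' h'
    replace h : (a : R) - a' ∈ I ^ (i + 1) := (Submodule.quotientRel_def ((I ^ (i + 1)).submoduleOf (I ^ i))).1 h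
    replace h' : (b : R) - b' ∈ I ^ (j + 1) := (Submodule.quotientRel_def ((I ^ (j + 1)).submoduleOf (I ^ j))).1 h'
    refine (Submodule.quotientRel_def
      ((I ^ (i + j + 1)).submoduleOf (I ^ (i + j)))).2 ?_
    change (a : R) * b - a' * b' ∈ I ^ (i + j + 1)
    have e : (a : R) * b - a' * b' = (a - a') * b + a' * (b - b') := by ring
    have h1 : ((a : R) - a') * b ∈ I ^ (i + j + 1) := by
      have := mul_mem_pow_add h b.2
      rwa [show i + 1 + j = i + j + 1 by omega] at this
    have h2 : (a' : R) * (b - b') ∈ I ^ (i + j + 1) :=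
      mul_mem_pow_add (i := i) (j := j + 1) a'.2 h'
    exact e ▸ add_mem h1 h2)

theorem grMul_grMk {i j : ℕ} {a b : R} (ha : a ∈ I ^ i) (hb : b ∈ I ^ j) :
    grMul (I.grMk i a ha) (I.grMk j b hb) = I.grMk (i + j) (a * b) (mul_mem_pow_add ha hb) :=
  rfl

theorem grMk_add {n : ℕ} {a b : R} (ha : a ∈ I ^ n) (hb : b ∈ I ^ n) :
    I.grMk n a ha + I.grMk n b hb = I.grMk n (a + b) (add_mem ha hb) :=
  rfl

theorem grMk_zero {n : ℕ} : I.grMk n 0 (zero_mem _) = 0 :=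
  rfl

theorem grMk_sigma_congr {i j : ℕ} {a b : R} {ha : a ∈ I ^ i} {hb : b ∈ I ^ j}
    (h : i = j) (h' : a = b) :
    (GradedMonoid.mk i (I.grMk i a ha) : GradedMonoid I.GrPiece) =
      GradedMonoid.mk j (I.grMk j b hb) := by
  subst h
  subst h'
  rfl

instance : GradedMonoid.GMul I.GrPiece := ⟨grMul⟩

instance : GradedMonoid.GOne I.GrPiece := ⟨I.grMk 0 1 (by simp)⟩

theorem mk_mul_grMk {i j : ℕ} {a b : R} (ha : a ∈ I ^ i) (hb : b ∈ I ^ j) :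
    (GradedMonoid.mk i (I.grMk i a ha) * GradedMonoid.mk j (I.grMk j b hb) :
      GradedMonoid I.GrPiece) =
      GradedMonoid.mk (i + j) (I.grMk (i + j) (a * b) (mul_mem_pow_add ha hb)) :=
  rfl

theorem gradedMonoid_one_eq :
    (1 : GradedMonoid I.GrPiece) = GradedMonoid.mk 0 (I.grMk 0 1 (by simp)) :=
  rfl

/-- The pieces `Iⁿ / Iⁿ⁺¹` form a commutative graded ring. -/
instance : DirectSum.GCommRing I.GrPiece where
  one_mul := by
    rintro ⟨i, q⟩
    obtain ⟨a, ha, rfl⟩ := exists_grMk q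
    exact (mk_mul_grMk _ _).trans (grMk_sigma_congr (zero_add i) (one_mul a))
  mul_one := by
    rintro ⟨i, q⟩
    obtain ⟨a, ha, rfl⟩ := exists_grMk q
    exact (mk_mul_grMk _ _).trans (grMk_sigma_congr (add_zero i) (mul_one a))
  mul_assoc := by
    rintro ⟨i, p⟩ ⟨j, q⟩ ⟨k, r⟩
    obtain ⟨a, ha, rfl⟩ := exists_grMk p
    obtain ⟨b, hb, rfl⟩ := exists_grMk q
    obtain ⟨c, hc, rfl⟩ := exists_grMk r
    exact grMk_sigma_congr (ha := mul_mem_pow_add (mul_mem_pow_add ha hb) hc)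
      (hb := mul_mem_pow_add ha (mul_mem_pow_add hb hc)) (add_assoc i j k) (mul_assoc a b c)
  mul_comm := by
    rintro ⟨i, p⟩ ⟨j, q⟩
    obtain ⟨a, ha, rfl⟩ := exists_grMk p
    obtain ⟨b, hb, rfl⟩ := exists_grMk q
    exact grMk_sigma_congr (ha := mul_mem_pow_add ha hb) (hb := mul_mem_pow_add hb ha)
      (add_comm i j) (mul_comm a b)
  mul_zero := by
    intro i j p
    obtain ⟨a, ha, rfl⟩ := exists_grMk p
    exact grMk_eq_grMk.2 (by simp)
  zero_mul := by
    intro i j p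
    obtain ⟨a, ha, rfl⟩ := exists_grMk p
    exact grMk_eq_grMk.2 (by simp)
  mul_add := by
    intro i j p q r
    obtain ⟨a, ha, rfl⟩ := exists_grMk p
    obtain ⟨b, hb, rfl⟩ := exists_grMk q
    obtain ⟨c, hc, rfl⟩ := exists_grMk r
    exact grMk_eq_grMk.2 (by simp [mul_add])
  add_mul := by
    intro i j p q r
    obtain ⟨a, ha, rfl⟩ := exists_grMk p
    obtain ⟨b, hb, rfl⟩ := exists_grMk q
    obtain ⟨c, hc, rfl⟩ := exists_grMk r
    exact grMk_eq_grMk.2 (by simp [add_mul])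
  natCast n := I.grMk 0 n (by simp)
  natCast_zero := grMk_eq_grMk.2 (by simp)
  natCast_succ n := grMk_eq_grMk.2 (by simp)
  intCast n := I.grMk 0 n (by simp)
  intCast_ofNat n := grMk_eq_grMk.2 (by simp)
  intCast_negSucc_ofNat n := grMk_eq_grMk.2 (by simp)

variable (I)

/-- The associated graded ring `gr_I R = ⨁ₙ Iⁿ / Iⁿ⁺¹`, with its usual multiplication. -/
abbrev AssociatedGradedRing : Type u :=
  ⨁ n : ℕ, I.GrPiece n

/-- The class in `I / I² ⊆ gr_I R` (degree one) of an element `x` of `I`. -/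
noncomputable def degreeOneClass (x : R) (hx : x ∈ I) : I.AssociatedGradedRing :=
  DirectSum.of I.GrPiece 1 (I.grMk 1 x (by simpa using hx))

end Ideal

end AssociatedGraded

section LinearityDefect

open IsLocalRing CategoryTheory

variable (R : Type u) [CommRing R] [IsLocalRing R]

/-- A minimal free resolution `⋯ → F₂ → F₁ → F₀ → M → 0` of `M` over the local ring `R`:
the modules `Fᵢ = R ^ rank i` are free of finite rank, the augmented complex is exact,
and `d Fᵢ₊₁ ⊆ 𝔪 Fᵢ` for all `i`. -/
structure MinimalFreeResolution (M : Type v) [AddCommGroup M] [Module R M] where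
  /-- the Betti numbers -/
  rank : ℕ → ℕ
  /-- the differential `Fᵢ₊₁ → Fᵢ` -/
  d : ∀ i, (Fin (rank (i + 1)) → R) →ₗ[R] (Fin (rank i) → R)
  /-- the augmentation `F₀ → M` -/
  aug : (Fin (rank 0) → R) →ₗ[R] M
  aug_surjective : Function.Surjective aug
  exact_aug : Function.Exact (d 0) aug
  exact_d : ∀ i, Function.Exact (d (i + 1)) (d i)
  minimal : ∀ i, LinearMap.range (d i) ≤ maximalIdeal R • ⊤

/-- A finitely generated module has a surjection from a free module of finite rank whose kernel
lies in `𝔪` times the free module. -/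
theorem exists_minimal_cover (M : Type v) [AddCommGroup M] [Module R M] [Module.Finite R M] :
    ∃ (n : ℕ) (f : (Fin n → R) →ₗ[R] M), Function.Surjective f ∧
      LinearMap.ker f ≤ maximalIdeal R • ⊤ := by
  let b := Module.finBasis (ResidueField R) (TensorProduct R (ResidueField R) M)
  obtain ⟨v, hv⟩ := (TensorProduct.mk_surjective R M (ResidueField R)
    Ideal.Quotient.mk_surjective).comp_left b
  refine ⟨_, Fintype.linearCombination R v, ?_, ?_⟩
  · rw [← LinearMap.range_eq_top, Fintype.range_linearCombination]
    exact span_eq_top_of_tmul_eq_basis v b fun i => congr_fun hv i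
  · intro r hr
    have h0 : ∑ i, residue R (r i) • b i = 0 := by
      have h1 := congrArg (TensorProduct.mk R (ResidueField R) M 1) (LinearMap.mem_ker.1 hr)
      rw [Fintype.linearCombination_apply, map_sum, map_zero] at h1
      rw [← h1]
      refine Finset.sum_congr rfl fun i _ => ?_
      rw [map_smul, ← congr_fun hv i]
      exact algebraMap_smul (ResidueField R) (r i) _
    have h2 : ∀ i, r i ∈ maximalIdeal R := fun i =>
      (residue_eq_zero_iff _).1 (Fintype.linearIndependent_iff.1 b.linearIndependent _ h0 i)
    rw [pi_eq_sum_univ' r]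
    exact Submodule.sum_mem _ fun i _ => Submodule.smul_mem_smul (h2 i) trivial

/-- Over a noetherian local ring every finitely generated module has a minimal free
resolution. -/
theorem MinimalFreeResolution.nonempty [IsNoetherianRing R] (M : Type v) [AddCommGroup M]
    [Module R M] [Module.Finite R M] : Nonempty (MinimalFreeResolution R M) := by
  obtain ⟨n₀, f₀, hs₀, hk₀⟩ := exists_minimal_cover R M
  have key : ∀ (n : ℕ) (K : Submodule R (Fin n → R)), ∃ (m : ℕ)
      (g : (Fin m → R) →ₗ[R] (Fin n → R)), LinearMap.range g = K ∧
        LinearMap.ker g ≤ maximalIdeal R • ⊤ := by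
    intro n K
    obtain ⟨m, g, hs, hk⟩ := exists_minimal_cover R K
    refine ⟨m, K.subtype ∘ₗ g, ?_, ?_⟩
    · rw [LinearMap.range_comp, LinearMap.range_eq_top.2 hs, Submodule.map_top,
        Submodule.range_subtype]
    · rwa [LinearMap.ker_comp_of_ker_eq_bot _ K.ker_subtype]
  choose m g hr hk using key
  let S := Σ n : ℕ, {K : Submodule R (Fin n → R) // K ≤ maximalIdeal R • ⊤}
  let next : S → S := fun s => ⟨m s.1 s.2.1, LinearMap.ker (g s.1 s.2.1), hk _ _⟩
  let s : ℕ → S := fun i => Nat.rec ⟨n₀, LinearMap.ker f₀, hk₀⟩ (fun _ t => next t) i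
  exact ⟨{
    rank := fun i => (s i).1
    d := fun i => g (s i).1 (s i).2.1
    aug := f₀
    aug_surjective := hs₀
    exact_aug := LinearMap.exact_iff.2 (hr _ _).symm
    exact_d := fun i => LinearMap.exact_iff.2 (hr _ _).symm
    minimal := fun i => (hr _ _).trans_le (s i).2.2 }⟩

namespace MinimalFreeResolution

variable {R} {M : Type v} [AddCommGroup M] [Module R M] (F : MinimalFreeResolution R M)

/-- The free module `Fᵢ`. -/
abbrev X (i : ℕ) : Type u := Fin (F.rank i) → R

/-- The filtration `(𝒢ⁿF)ᵢ = 𝔪ⁿ⁻ⁱ Fᵢ`, where `𝔪ʲ = R` for `j ≤ 0`; the subtraction of natural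
numbers, which is `0` for `n ≤ i`, does exactly this. (For `n < 0` one would get `Fᵢ` again, so
the quotients of the filtration in negative degrees vanish.) -/
def filtration (n i : ℕ) : Submodule R (F.X i) :=
  maximalIdeal R ^ (n - i) • ⊤

theorem d_mem_filtration (n i : ℕ) :
    ∀ a ∈ F.filtration n (i + 1), F.d i a ∈ F.filtration n i := by
  intro a ha
  unfold filtration at ha ⊢
  have h1 : F.d i a ∈ (maximalIdeal R ^ (n - (i + 1)) • ⊤ : Submodule R (F.X (i + 1))).map (F.d i) :=
    Submodule.mem_map_of_mem ha
  rw [Submodule.map_smul'', Submodule.map_top] at h1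
  have h2 := Submodule.smul_mono (le_refl (maximalIdeal R ^ (n - (i + 1)))) (F.minimal i) h1
  rw [← smul_assoc, smul_eq_mul, ← pow_succ] at h2
  exact Submodule.smul_mono_left (Ideal.pow_le_pow_right (by omega)) h2

/-- The quotient `(𝒢ⁿF)ᵢ / (𝒢ⁿ⁺¹F)ᵢ`. -/
def GrX (n i : ℕ) : Type u :=
  ↥(F.filtration n i) ⧸ (F.filtration (n + 1) i).submoduleOf (F.filtration n i)

instance (n i : ℕ) : AddCommGroup (F.GrX n i) :=
  inferInstanceAs (AddCommGroup
    (↥(F.filtration n i) ⧸ (F.filtration (n + 1) i).submoduleOf (F.filtration n i)))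

instance (n i : ℕ) : Module R (F.GrX n i) :=
  inferInstanceAs (Module R
    (↥(F.filtration n i) ⧸ (F.filtration (n + 1) i).submoduleOf (F.filtration n i)))

/-- The map `(𝒢ⁿF)ᵢ₊₁ / (𝒢ⁿ⁺¹F)ᵢ₊₁ → (𝒢ⁿF)ᵢ / (𝒢ⁿ⁺¹F)ᵢ` induced by the differential. -/
def grD (n i : ℕ) : F.GrX n (i + 1) →ₗ[R] F.GrX n i :=
  Submodule.mapQ _ _ ((F.d i).restrict (F.d_mem_filtration n i))
    fun a ha => F.d_mem_filtration (n + 1) i a ha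

theorem grD_comp_grD (n i : ℕ) : F.grD n i ∘ₗ F.grD n (i + 1) = 0 := by
  refine LinearMap.ext fun q => ?_
  obtain ⟨a, rfl⟩ := Submodule.Quotient.mk_surjective _ q
  refine (Submodule.Quotient.mk_eq_zero _).2 ?_
  change F.d i (F.d (i + 1) a) ∈ F.filtration (n + 1) i
  rw [(F.exact_d i).apply_apply_eq_zero]
  exact zero_mem _

/-- The linear part of `F`: the associated graded complex
`⨁ₙ 𝒢ⁿF / 𝒢ⁿ⁺¹F` of the filtration `𝒢`. -/
noncomputable def linearPart : ChainComplex (ModuleCat.{u} R) ℕ :=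
  ChainComplex.of (fun i => ModuleCat.of R (⨁ n, F.GrX n i))
    (fun i => ModuleCat.ofHom (DirectSum.lmap fun n => F.grD n i)) fun i => by
      rw [← ModuleCat.ofHom_comp, ← DirectSum.lmap_comp]
      refine ModuleCat.hom_ext (LinearMap.ext fun x => DFinsupp.ext fun n => ?_)
      exact LinearMap.congr_fun (F.grD_comp_grD n i) (x n)

/-- `sup {i : Hᵢ(lin F) ≠ 0}`, with `sup ∅ = 0`. -/
noncomputable def linearityDefect : ℕ∞ :=
  ⨆ (i : ℕ) (_ : ¬ Limits.IsZero (F.linearPart.homology i)), (i : ℕ∞)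

end MinimalFreeResolution

/-- The linearity defect `ld_R M = sup {i : Hᵢ(lin F) ≠ 0}`, where `F` is the minimal free
resolution of `M`. Any two minimal free resolutions of `M` are isomorphic, so the outer supremum
is over copies of one value. For `M = 0` the value is `0`. -/
noncomputable def linearityDefect (M : Type v) [AddCommGroup M] [Module R M] : ℕ∞ :=
  ⨆ F : MinimalFreeResolution R M, F.linearityDefect

/-- A noetherian local ring is absolutely Koszul if all its finitely generated modules have finite
linearity defect. -/
def IsAbsolutelyKoszul (R : Type u) [CommRing R] [IsLocalRing R] [IsNoetherianRing R] : Prop :=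
  ∀ (M : Type u) [AddCommGroup M] [Module R M] [Module.Finite R M], linearityDefect R M < ⊤

end LinearityDefect

/-!
Write `S = R / (x)` and let `G` be the minimal free resolution over `S` of an `S`-module. Lift its
differentials to maps `d` between free `R`-modules `Pᵢ`. Then `d d = x t` for some maps `t`, and the
maps `(a, b) ↦ (d a + x b, -(t a + d b))` on the modules `Pᵢ × Pᵢ₋₁` form the minimal free
resolution over `R` of the same module. The second component of such a value is determined by the
first, because `d (d a + x b) = x (t a + d b)`; and as `x` has a regular initial form, it lies in
`𝔪ᵏ Pᵢ₋₁` whenever the first one lies in `𝔪ᵏ Pᵢ`. Hence cycles of the linear part of `G` lift to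
cycles of the linear part over `R`, and vanishing of homology descends to `G`: the linearity defect
over `S` is at most the one over `R`.
-/

open IsLocalRing CategoryTheory

section AdicFiltration

variable {R : Type*} [CommRing R] {I : Ideal R} {M N : Type*} [AddCommGroup M] [Module R M]
  [AddCommGroup N] [Module R N]

theorem map_mem_smul_top (f : M →ₗ[R] N) {m : M} (hm : m ∈ (I • ⊤ : Submodule R M)) :
    f m ∈ (I • ⊤ : Submodule R N) :=
  Submodule.smul_top_le_comap_smul_top I f hm

theorem linearEquiv_mem_smul_top_iff (e : M ≃ₗ[R] N) {m : M} :
    e m ∈ (I • ⊤ : Submodule R N) ↔ m ∈ (I • ⊤ : Submodule R M) :=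
  ⟨fun h => by simpa using map_mem_smul_top e.symm.toLinearMap h, map_mem_smul_top e.toLinearMap⟩

theorem mem_smul_top_prod_iff {p : M × N} :
    p ∈ (I • ⊤ : Submodule R (M × N)) ↔
      p.1 ∈ (I • ⊤ : Submodule R M) ∧ p.2 ∈ (I • ⊤ : Submodule R N) := by
  refine ⟨fun h => ⟨map_mem_smul_top (.fst R M N) h, map_mem_smul_top (.snd R M N) h⟩,
    fun h => ?_⟩
  simpa using add_mem (map_mem_smul_top (.inl R M N) h.1) (map_mem_smul_top (.inr R M N) h.2)

theorem mem_smul_top_pi_iff {ι : Type*} [Finite ι] {M : ι → Type*} [∀ i, AddCommGroup (M i)]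
    [∀ i, Module R (M i)] {m : ∀ i, M i} :
    m ∈ (I • ⊤ : Submodule R (∀ i, M i)) ↔ ∀ i, m i ∈ (I • ⊤ : Submodule R (M i)) := by
  classical
  have := Fintype.ofFinite ι
  refine ⟨fun h i => map_mem_smul_top (.proj i) h, fun h => ?_⟩
  rw [← Finset.univ_sum_single m]
  exact sum_mem fun i _ => map_mem_smul_top (.single R M i) (h i)

theorem map_mem_pow_succ_smul_top {f : M →ₗ[R] N} (hf : LinearMap.range f ≤ I • ⊤) {k : ℕ} {m : M}
    (hm : m ∈ (I ^ k • ⊤ : Submodule R M)) : f m ∈ (I ^ (k + 1) • ⊤ : Submodule R N) := by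
  have hfm : f m ∈ (I ^ k • ⊤ : Submodule R M).map f := Submodule.mem_map_of_mem hm
  rw [Submodule.map_smul'', Submodule.map_top] at hfm
  rw [pow_succ, Submodule.mul_smul]
  exact Submodule.smul_mono le_rfl hf hfm

theorem exists_mem_smul_top_apply_eq {f : M →ₗ[R] N} (hf : Function.Surjective f) {n : N}
    (hn : n ∈ (I • ⊤ : Submodule R N)) : ∃ m ∈ (I • ⊤ : Submodule R M), f m = n := by
  rwa [← Submodule.mem_map, Submodule.map_smul'', Submodule.map_top, LinearMap.range_eq_top.2 hf]

theorem mem_pow_smul_top_of_le {j k : ℕ} (h : j ≤ k) {m : M}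
    (hm : m ∈ (I ^ k • ⊤ : Submodule R M)) : m ∈ (I ^ j • ⊤ : Submodule R M) :=
  Submodule.smul_mono_left (Ideal.pow_le_pow_right h) hm

theorem mem_map_pow_smul_top_iff (S : Type*) [CommRing S] [Algebra R S] [Module S M]
    [IsScalarTower R S M] {k : ℕ} {m : M} :
    m ∈ (I.map (algebraMap R S) ^ k • ⊤ : Submodule S M) ↔
      m ∈ (I ^ k • ⊤ : Submodule R M) := by
  rw [← Ideal.map_pow, ← Submodule.restrictScalars_mem R, Ideal.smul_restrictScalars,
    Submodule.restrictScalars_top]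

end AdicFiltration

section StrictlyRegular

variable {R : Type*} [CommRing R]

/-- The colon condition `(Iᵏ⁺¹M : x) ⊆ IᵏM` for all `k`. For `M = R` and `x ∈ I` it says that the
initial form of `x` in `I / I²` is a non-zero-divisor on `gr_I R`. -/
def IsStrictlyRegular (I : Ideal R) (x : R) (M : Type*) [AddCommGroup M] [Module R M] : Prop :=
  ∀ ⦃k : ℕ⦄ ⦃m : M⦄, x • m ∈ (I ^ (k + 1) • ⊤ : Submodule R M) → m ∈ (I ^ k • ⊤ : Submodule R M)

namespace IsStrictlyRegular

variable {I : Ideal R} {x : R}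

theorem of_degreeOneClass_mem_nonZeroDivisors (hx : x ∈ I)
    (hreg : I.degreeOneClass x hx ∈ nonZeroDivisors I.AssociatedGradedRing) :
    IsStrictlyRegular I x R := by
  intro k y hxy
  rw [smul_eq_mul, smul_eq_mul, Ideal.mul_top] at *
  -- If `y ∈ Iʲ` with `j < k`, then `xy ∈ Iʲ⁺²`, so the class of `y` in `Iʲ / Iʲ⁺¹` is killed by
  -- that of `x`.
  suffices ∀ j ≤ k, y ∈ I ^ j from this k le_rfl
  intro j
  induction j with
  | zero => simp
  | succ j ih =>
    intro hj
    have hy : y ∈ I ^ j := ih (by omega)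
    have hmul : Ideal.grMul (I.grMk 1 x (by simpa using hx)) (I.grMk j y hy) = 0 :=
      (Ideal.grMk_eq_grMk (hb := zero_mem _)).2 <| by
        rw [sub_zero]
        exact Ideal.pow_le_pow_right (by omega) hxy
    have hclass : DirectSum.of I.GrPiece j (I.grMk j y hy) = 0 := by
      refine (mem_nonZeroDivisors_iff.1 hreg).1 _ ?_
      rw [Ideal.degreeOneClass, DirectSum.of_mul_of]
      exact (congrArg _ hmul).trans (map_zero _)
    have hgrMk : I.grMk j y hy = I.grMk j 0 (zero_mem _) :=
      DirectSum.of_injective j (hclass.trans (map_zero _).symm)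
    simpa using Ideal.grMk_eq_grMk.1 hgrMk

theorem pi {ι : Type*} [Finite ι] {M : ι → Type*} [∀ i, AddCommGroup (M i)]
    [∀ i, Module R (M i)] (h : ∀ i, IsStrictlyRegular I x (M i)) :
    IsStrictlyRegular I x (∀ i, M i) := by
  intro k m hm
  rw [mem_smul_top_pi_iff] at hm ⊢
  exact fun i => h i (hm i)

variable {M : Type*} [AddCommGroup M] [Module R M]

theorem isSMulRegular [IsHausdorff I M] (h : IsStrictlyRegular I x M) : IsSMulRegular M x := by
  refine IsSMulRegular.of_right_eq_zero_of_smul fun m hm =>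
    IsHausdorff.haus' (I := I) m fun k => SModEq.zero.2 (h ?_)
  rw [hm]
  exact zero_mem _

end IsStrictlyRegular

end StrictlyRegular

section LinearlyExact

variable {R : Type*} [CommRing R] {A B C A' B' C' : Type*} [AddCommGroup A] [Module R A]
  [AddCommGroup B] [Module R B] [AddCommGroup C] [Module R C] [AddCommGroup A'] [Module R A']
  [AddCommGroup B'] [Module R B'] [AddCommGroup C'] [Module R C']

/-- Exactness at `B` of the linear part `gr_I A (-1) → gr_I B → gr_I C (1)` of `A → B → C`, for maps
with images in `IB` and `IC`. For `k = 0` the truncated subtraction gives `I⁰ = R`; as `f a ∈ IB`,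
the condition then says that `b ∈ IB`. -/
def IsLinearlyExact (I : Ideal R) (f : A →ₗ[R] B) (g : B →ₗ[R] C) : Prop :=
  ∀ ⦃k : ℕ⦄ ⦃b : B⦄, b ∈ (I ^ k • ⊤ : Submodule R B) →
    g b ∈ (I ^ (k + 2) • ⊤ : Submodule R C) →
    ∃ a ∈ (I ^ (k - 1) • ⊤ : Submodule R A), b - f a ∈ (I ^ (k + 1) • ⊤ : Submodule R B)

theorem IsLinearlyExact.of_ladder_linearEquiv {I : Ideal R} {f : A →ₗ[R] B} {g : B →ₗ[R] C}
    {f' : A' →ₗ[R] B'} {g' : B' →ₗ[R] C'} {eA : A ≃ₗ[R] A'} {eB : B ≃ₗ[R] B'} {eC : C ≃ₗ[R] C'}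
    (hf : ∀ a, eB (f a) = f' (eA a)) (hg : ∀ b, eC (g b) = g' (eB b))
    (h : IsLinearlyExact I f g) : IsLinearlyExact I f' g' := by
  intro k b' hb' hgb'
  obtain ⟨b, rfl⟩ := eB.surjective b'
  rw [← hg, linearEquiv_mem_smul_top_iff] at hgb'
  obtain ⟨a, ha, hab⟩ := h ((linearEquiv_mem_smul_top_iff eB).1 hb') hgb'
  refine ⟨eA a, (linearEquiv_mem_smul_top_iff eA).2 ha, ?_⟩
  rwa [← hf, ← map_sub, linearEquiv_mem_smul_top_iff]

theorem isLinearlyExact_restrictScalars_iff {S : Type*} [CommRing S] [Algebra R S] [Module S A]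
    [Module S B] [Module S C] [IsScalarTower R S A] [IsScalarTower R S B] [IsScalarTower R S C]
    {I : Ideal R} {f : A →ₗ[S] B} {g : B →ₗ[S] C} :
    IsLinearlyExact I (f.restrictScalars R) (g.restrictScalars R) ↔
      IsLinearlyExact (I.map (algebraMap R S)) f g := by
  simp only [IsLinearlyExact, mem_map_pow_smul_top_iff, LinearMap.restrictScalars_apply]

end LinearlyExact

theorem directSum_lmap_exact_iff {R ι : Type*} [Ring R] {A B C : ι → Type*}
    [∀ i, AddCommGroup (A i)] [∀ i, Module R (A i)] [∀ i, AddCommGroup (B i)]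
    [∀ i, Module R (B i)] [∀ i, AddCommGroup (C i)] [∀ i, Module R (C i)]
    {f : ∀ i, A i →ₗ[R] B i} {g : ∀ i, B i →ₗ[R] C i} :
    Function.Exact (DirectSum.lmap f) (DirectSum.lmap g) ↔
      ∀ i, Function.Exact (f i) (g i) := by
  classical
  refine ⟨fun h i b => ?_, fun h => ?_⟩
  · have hb := h (DirectSum.lof R ι B i b)
    rw [DirectSum.lmap_lof] at hb
    constructor
    · intro hgb
      obtain ⟨z, hz⟩ := hb.1 (by rw [hgb, map_zero])
      refine ⟨z i, ?_⟩
      rw [← DirectSum.lmap_apply, hz, DirectSum.lof_apply]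
    · rintro ⟨a, rfl⟩
      have := hb.2 ⟨DirectSum.lof R ι A i a, DirectSum.lmap_lof f i a⟩
      exact DirectSum.of_injective i (this.trans (map_zero _).symm)
  · simp only [LinearMap.exact_iff] at h ⊢
    simp only [DirectSum.ker_lmap, DirectSum.range_lmap, h]

namespace MinimalFreeResolution

variable {R : Type u} [CommRing R] [IsLocalRing R] {M : Type v} [AddCommGroup M] [Module R M]

section LinearPart

variable (F : MinimalFreeResolution R M)

theorem linearPart_d (i : ℕ) :
    F.linearPart.d (i + 1) i = ModuleCat.ofHom (DirectSum.lmap fun n => F.grD n i) :=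
  ChainComplex.of_d (fun i => ModuleCat.of R (⨁ n, F.GrX n i))
    (fun i => ModuleCat.ofHom (DirectSum.lmap fun n => F.grD n i)) i

theorem isZero_homology_linearPart_iff_exact_grD (j : ℕ) :
    Limits.IsZero (F.linearPart.homology (j + 1)) ↔
      ∀ n, Function.Exact (F.grD n (j + 1)) (F.grD n j) := by
  rw [← HomologicalComplex.exactAt_iff_isZero_homology,
    HomologicalComplex.exactAt_iff' _ (j + 1 + 1) (j + 1) j (by simp) (by simp),
    ShortComplex.ShortExact.moduleCat_exact_iff_function_exact, ← directSum_lmap_exact_iff (R := R)]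
  change Function.Exact (F.linearPart.d (j + 1 + 1) (j + 1)) (F.linearPart.d (j + 1) j) ↔ _
  rw [linearPart_d, linearPart_d]
  rfl

theorem exact_grD_iff (n j : ℕ) :
    Function.Exact (F.grD n (j + 1)) (F.grD n j) ↔
      ∀ b ∈ F.filtration n (j + 1), F.d j b ∈ F.filtration (n + 1) j →
        ∃ a ∈ F.filtration n (j + 2), b - F.d (j + 1) a ∈ F.filtration (n + 1) (j + 1) := by
  have mk_eq_zero {i : ℕ} (a : F.filtration n i) :
      (Submodule.Quotient.mk a : F.GrX n i) = 0 ↔ (a : F.X i) ∈ F.filtration (n + 1) i :=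
    Submodule.Quotient.mk_eq_zero _
  have mk_eq_mk {i : ℕ} (a b : F.filtration n i) :
      (Submodule.Quotient.mk a : F.GrX n i) = Submodule.Quotient.mk b ↔
        (a : F.X i) - b ∈ F.filtration (n + 1) i :=
    Submodule.Quotient.eq _
  refine ⟨fun h b hb hdb => ?_, fun h => ?_⟩
  · obtain ⟨q, hq⟩ := (h (Submodule.Quotient.mk ⟨b, hb⟩)).1 ((mk_eq_zero _).2 hdb)
    obtain ⟨⟨a, ha⟩, rfl⟩ := Submodule.Quotient.mk_surjective _ q
    exact ⟨a, ha, (mk_eq_mk _ _).1 hq.symm⟩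
  · refine LinearMap.exact_of_comp_of_mem_range (F.grD_comp_grD n j) fun q hq => ?_
    obtain ⟨⟨b, hb⟩, rfl⟩ := Submodule.Quotient.mk_surjective _ q
    obtain ⟨a, ha, hab⟩ := h b hb ((mk_eq_zero _).1 hq)
    exact ⟨Submodule.Quotient.mk ⟨a, ha⟩, ((mk_eq_mk ⟨b, hb⟩ _).2 hab).symm⟩

theorem isZero_homology_linearPart_iff (j : ℕ) :
    Limits.IsZero (F.linearPart.homology (j + 1)) ↔
      IsLinearlyExact (maximalIdeal R) (F.d (j + 1)) (F.d j) := by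
  simp only [isZero_homology_linearPart_iff_exact_grD, exact_grD_iff, filtration]
  have hsub (k : ℕ) : j + 1 + k - (j + 1) = k ∧ j + 1 + k + 1 - j = k + 2 ∧
      j + 1 + k - (j + 2) = k - 1 ∧ j + 1 + k + 1 - (j + 1) = k + 1 := by omega
  refine ⟨fun h k b hb hdb => ?_, fun h n b hb hdb => ?_⟩
  · simpa only [hsub] using h (j + 1 + k) b (by rwa [(hsub k).1]) (by rwa [(hsub k).2.1])
  · obtain hn | ⟨k, rfl⟩ : n ≤ j ∨ ∃ k, n = j + 1 + k :=
      (Nat.lt_or_ge j n).symm.imp_right Nat.exists_eq_add_of_le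
    · refine ⟨0, zero_mem _, ?_⟩
      rw [Nat.sub_eq_zero_of_le (by omega), pow_zero, Ideal.one_eq_top, Submodule.top_smul]
      trivial
    · simp only [hsub] at hb hdb ⊢
      exact h hb hdb

end LinearPart

/-- The minimal free resolution with the given ranks which is isomorphic, through the `e i`, to a
given resolution by free modules `P i`. -/
def ofLinearEquiv {P : ℕ → Type*} [∀ i, AddCommGroup (P i)] [∀ i, Module R (P i)] {r : ℕ → ℕ}
    (e : ∀ i, (Fin (r i) → R) ≃ₗ[R] P i) (d : ∀ i, P (i + 1) →ₗ[R] P i) (aug : P 0 →ₗ[R] M)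
    (aug_surjective : Function.Surjective aug) (exact_aug : Function.Exact (d 0) aug)
    (exact_d : ∀ i, Function.Exact (d (i + 1)) (d i))
    (minimal : ∀ i, LinearMap.range (d i) ≤ maximalIdeal R • ⊤) : MinimalFreeResolution R M where
  rank := r
  d i := (e i).symm.toLinearMap ∘ₗ d i ∘ₗ (e (i + 1)).toLinearMap
  aug := aug ∘ₗ (e 0).toLinearMap
  aug_surjective := aug_surjective.comp (e 0).surjective
  exact_aug := by
    refine exact_aug.of_ladder_linearEquiv_of_exact (e₁ := (e 1).symm) (e₂ := (e 0).symm)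
      (e₃ := .refl R M) ?_ ?_ <;> ext <;> simp
  exact_d i := by
    refine (exact_d i).of_ladder_linearEquiv_of_exact (e₁ := (e (i + 2)).symm)
      (e₂ := (e (i + 1)).symm) (e₃ := (e i).symm) ?_ ?_ <;> ext <;> simp
  minimal i := by
    rintro _ ⟨y, rfl⟩
    exact map_mem_smul_top (e i).symm.toLinearMap (minimal i ⟨_, rfl⟩)

end MinimalFreeResolution

/-- The reduction modulo `x` of a sequence of modules `P i` to the terms of a complex `(Q, δ)`,
together with lifts `d` of the differentials `δ`. As `δ δ = 0`, the squares of the lifts are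
multiples of `x`, namely `d d = x t`. -/
structure ComplexLift {R : Type*} [CommRing R] (x : R) (P : ℕ → Type*) {Q : ℕ → Type*}
    [∀ i, AddCommGroup (P i)] [∀ i, Module R (P i)] [∀ i, AddCommGroup (Q i)]
    [∀ i, Module R (Q i)] (δ : ∀ i, Q (i + 1) →ₗ[R] Q i) where
  /-- the reductions, which identify `Q i` with `P i / x P i` -/
  reduction : ∀ i, P i →ₗ[R] Q i
  /-- the lifted differentials -/
  d : ∀ i, P (i + 1) →ₗ[R] P i
  /-- the squares of the lifted differentials, divided by `x` -/
  t : ∀ i, P (i + 2) →ₗ[R] P i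
  reduction_surjective : ∀ i, Function.Surjective (reduction i)
  exact_reduction : ∀ i, Function.Exact (LinearMap.lsmul R (P i) x) (reduction i)
  reduction_d : ∀ i a, reduction i (d i a) = δ i (reduction (i + 1) a)
  d_d : ∀ i a, d i (d (i + 1) a) = x • t i a

namespace ComplexLift

variable {R : Type*} [CommRing R] {x : R} {P Q : ℕ → Type*} [∀ i, AddCommGroup (P i)]
  [∀ i, Module R (P i)] [∀ i, AddCommGroup (Q i)] [∀ i, Module R (Q i)]
  {δ : ∀ i, Q (i + 1) →ₗ[R] Q i}

theorem nonempty [∀ i, Module.Projective R (P i)] (hδ : ∀ i, δ i ∘ₗ δ (i + 1) = 0)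
    (π : ∀ i, P i →ₗ[R] Q i) (hπ : ∀ i, Function.Surjective (π i))
    (hxπ : ∀ i, Function.Exact (LinearMap.lsmul R (P i) x) (π i)) :
    Nonempty (ComplexLift x P δ) := by
  choose d hd using fun i =>
    Module.projective_lifting_property (π i) (δ i ∘ₗ π (i + 1)) (hπ i)
  replace hd i a : π i (d i a) = δ i (π (i + 1) a) := LinearMap.congr_fun (hd i) a
  have hdd i a : d i (d (i + 1) a) ∈ LinearMap.range (LinearMap.lsmul R (P i) x) :=
    (hxπ i _).1 <| by rw [hd, hd]; exact LinearMap.congr_fun (hδ i) _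
  choose t ht using fun i => Module.projective_lifting_property
    (LinearMap.lsmul R (P i) x).rangeRestrict ((d i ∘ₗ d (i + 1)).codRestrict _ (hdd i))
    (LinearMap.surjective_rangeRestrict _)
  exact ⟨⟨π, d, t, hπ, hxπ, hd,
    fun i a => (congrArg Subtype.val (LinearMap.congr_fun (ht i) a)).symm⟩⟩

variable (L : ComplexLift x P δ)

theorem reduction_smul (i : ℕ) (b : P i) : L.reduction i (x • b) = 0 :=
  (L.exact_reduction i).apply_apply_eq_zero b

theorem exists_smul_eq_sub {i : ℕ} {a b : P i} (h : L.reduction i a = L.reduction i b) :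
    ∃ c, x • c = a - b :=
  (L.exact_reduction i _).1 <| by rw [map_sub, h, sub_self]

/-- The differential of a cone-like complex with terms `P (i + 1) × P i`, which is exact along with
`δ`. As `d d = x t` need not vanish, the second component involves `t`. -/
def coneD (i : ℕ) : P (i + 2) × P (i + 1) →ₗ[R] P (i + 1) × P i :=
  (L.d (i + 1) ∘ₗ LinearMap.fst R _ _ + x • LinearMap.snd R _ _).prod
    (-(L.t i ∘ₗ LinearMap.fst R _ _ + L.d i ∘ₗ LinearMap.snd R _ _))

theorem fst_coneD (i : ℕ) (p : P (i + 2) × P (i + 1)) :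
    (L.coneD i p).1 = L.d (i + 1) p.1 + x • p.2 :=
  rfl

theorem snd_coneD (i : ℕ) (p : P (i + 2) × P (i + 1)) :
    (L.coneD i p).2 = -(L.t i p.1 + L.d i p.2) :=
  rfl

theorem d_fst_coneD (i : ℕ) (p : P (i + 2) × P (i + 1)) :
    L.d i (L.coneD i p).1 = -(x • (L.coneD i p).2) := by
  rw [fst_coneD, snd_coneD, map_add, map_smul, L.d_d, smul_neg, neg_neg, smul_add]

theorem reduction_fst_coneD (i : ℕ) (p : P (i + 2) × P (i + 1)) :
    L.reduction (i + 1) (L.coneD i p).1 = δ (i + 1) (L.reduction (i + 2) p.1) := by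
  rw [fst_coneD, map_add, L.reduction_d, L.reduction_smul, add_zero]

theorem exists_fst_coneD_eq {i : ℕ} {a : P (i + 2)} {c : P (i + 1)}
    (h : L.reduction (i + 1) c = δ (i + 1) (L.reduction (i + 2) a)) :
    ∃ b, (L.coneD i (a, b)).1 = c := by
  obtain ⟨b, hb⟩ := L.exists_smul_eq_sub (h.trans (L.reduction_d _ _).symm)
  exact ⟨b, by rw [fst_coneD, hb, add_sub_cancel]⟩

section Exactness

variable (hx : ∀ i, IsSMulRegular (P i) x)
include hx

theorem coneD_eq_zero_of_fst {i : ℕ} {p : P (i + 2) × P (i + 1)} (hp : (L.coneD i p).1 = 0) :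
    L.coneD i p = 0 := by
  refine Prod.ext hp ((hx i).right_eq_zero_of_smul ?_)
  rw [← neg_eq_zero, ← L.d_fst_coneD, hp, map_zero]

theorem coneD_coneD (i : ℕ) (p : P (i + 3) × P (i + 2)) :
    L.coneD i (L.coneD (i + 1) p) = 0 :=
  L.coneD_eq_zero_of_fst hx <| by rw [fst_coneD, L.d_fst_coneD, neg_add_cancel]

theorem exact_coneD {i : ℕ} (hδ : Function.Exact (δ (i + 2)) (δ (i + 1))) :
    Function.Exact (L.coneD (i + 1)) (L.coneD i) := by
  refine fun p => ⟨fun hp => ?_, ?_⟩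
  · obtain ⟨α, hα⟩ := (hδ (L.reduction (i + 2) p.1)).1 <| by
      rw [← L.reduction_fst_coneD, hp, Prod.fst_zero, map_zero]
    obtain ⟨a, rfl⟩ := L.reduction_surjective _ α
    obtain ⟨b, hab⟩ := L.exists_fst_coneD_eq hα.symm
    refine ⟨(a, b), Prod.ext hab (hx _ ?_)⟩
    have h := congrArg Prod.fst ((L.coneD_coneD hx i (a, b)).trans hp.symm)
    rw [fst_coneD, hab, fst_coneD] at h
    exact add_left_cancel h
  · rintro ⟨q, rfl⟩
    exact L.coneD_coneD hx i q

end Exactness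

theorem exact_coneD_aug [Subsingleton (P 0)] {M : Type*} [AddCommGroup M] [Module R M]
    {ε : Q 1 →ₗ[R] M} (hε : Function.Exact (δ 1) ε) :
    Function.Exact (L.coneD 0) (ε ∘ₗ L.reduction 1 ∘ₗ LinearMap.fst R (P 1) (P 0)) := by
  refine fun p => ⟨fun hp => ?_, ?_⟩
  · obtain ⟨α, hα⟩ := (hε (L.reduction 1 p.1)).1 hp
    obtain ⟨a, rfl⟩ := L.reduction_surjective _ α
    obtain ⟨b, hab⟩ := L.exists_fst_coneD_eq hα.symm
    exact ⟨(a, b), Prod.ext hab (Subsingleton.elim _ _)⟩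
  · rintro ⟨q, rfl⟩
    change ε (L.reduction 1 (L.coneD 0 q).1) = 0
    rw [L.reduction_fst_coneD, hε.apply_apply_eq_zero]

section Minimality

variable {I : Ideal R} (hxI : x ∈ I) (hδ : ∀ i, LinearMap.range (δ i) ≤ I • ⊤)
include hxI hδ

theorem range_d_le (i : ℕ) : LinearMap.range (L.d i) ≤ I • ⊤ := by
  rintro _ ⟨a, rfl⟩
  have hda : L.reduction i (L.d i a) ∈ (I • ⊤ : Submodule R (Q i)) := by
    rw [L.reduction_d]
    exact hδ i ⟨_, rfl⟩
  obtain ⟨e, he, hed⟩ := exists_mem_smul_top_apply_eq (L.reduction_surjective i) hda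
  obtain ⟨b, hb⟩ := L.exists_smul_eq_sub hed.symm
  rw [eq_add_of_sub_eq hb.symm]
  exact add_mem (Submodule.smul_mem_smul hxI trivial) he

variable (hx : ∀ i, IsStrictlyRegular I x (P i))
include hx

theorem coneD_mem_of_fst {i k : ℕ} {p : P (i + 2) × P (i + 1)}
    (hp : (L.coneD i p).1 ∈ (I ^ k • ⊤ : Submodule R (P (i + 1)))) :
    L.coneD i p ∈ (I ^ k • ⊤ : Submodule R (P (i + 1) × P i)) := by
  refine mem_smul_top_prod_iff.2 ⟨hp, hx i ?_⟩
  rw [← neg_mem_iff, ← L.d_fst_coneD]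
  exact map_mem_pow_succ_smul_top (L.range_d_le hxI hδ i) hp

theorem range_coneD_le (i : ℕ) : LinearMap.range (L.coneD i) ≤ I • ⊤ := by
  rintro _ ⟨p, rfl⟩
  rw [← pow_one I]
  refine L.coneD_mem_of_fst hxI hδ hx ?_
  rw [pow_one, fst_coneD]
  exact add_mem (L.range_d_le hxI hδ _ ⟨_, rfl⟩) (Submodule.smul_mem_smul hxI trivial)

theorem isLinearlyExact_of_coneD {i : ℕ} (h : IsLinearlyExact I (L.coneD (i + 1)) (L.coneD i)) :
    IsLinearlyExact I (δ (i + 2)) (δ (i + 1)) := by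
  intro k α hα hdα
  obtain ⟨a, ha, rfl⟩ := exists_mem_smul_top_apply_eq (L.reduction_surjective _) hα
  obtain ⟨e, he, hed⟩ := exists_mem_smul_top_apply_eq (L.reduction_surjective _) hdα
  obtain ⟨b, rfl⟩ := L.exists_fst_coneD_eq hed
  have hb : b ∈ (I ^ k • ⊤ : Submodule R (P (i + 1))) := by
    refine hx _ ((Submodule.add_mem_iff_right _ ?_).1 (mem_pow_smul_top_of_le (Nat.le_succ _) he))
    exact map_mem_pow_succ_smul_top (L.range_d_le hxI hδ _) ha
  obtain ⟨q, hq, hsub⟩ :=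
    h (mem_smul_top_prod_iff.2 ⟨ha, hb⟩) (L.coneD_mem_of_fst hxI hδ hx he)
  refine ⟨L.reduction _ q.1, map_mem_smul_top _ (mem_smul_top_prod_iff.1 hq).1, ?_⟩
  rw [← L.reduction_fst_coneD, ← map_sub]
  exact map_mem_smul_top _ (mem_smul_top_prod_iff.1 hsub).1

end Minimality

end ComplexLift

/-- The splitting of a free module of rank `m + n`, which turns the terms of a direct sum of free
modules of finite rank into the form required by `MinimalFreeResolution`. -/
def finAddPiEquiv (R : Type*) [Semiring R] (m n : ℕ) :
    (Fin (m + n) → R) ≃ₗ[R] (Fin m → R) × (Fin n → R) :=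
  (LinearEquiv.funCongrLeft R R finSumFinEquiv).trans (LinearEquiv.sumArrowLequivProdArrow _ _ R R)

theorem exact_lsmul_compLeft {R S : Type*} [CommRing R] [CommRing S] [Algebra R S] {x : R}
    (hxS : RingHom.ker (algebraMap R S) = Ideal.span {x}) (ι : Type*) :
    Function.Exact (LinearMap.lsmul R (ι → R) x) ((Algebra.linearMap R S).compLeft ι) := by
  have hker (r : R) : algebraMap R S r = 0 ↔ ∃ c, x * c = r := by
    rw [← RingHom.mem_ker, hxS, Ideal.mem_span_singleton]
    exact exists_congr fun _ => eq_comm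
  intro a
  simp only [funext_iff, LinearMap.compLeft_apply, Function.comp_apply, Algebra.linearMap_apply,
    Pi.zero_apply, hker, Set.mem_range, LinearMap.lsmul_apply, Pi.smul_apply, smul_eq_mul]
  exact Classical.skolem

theorem map_maximalIdeal_of_surjective {R S : Type*} [CommRing R] [IsLocalRing R] [CommRing S]
    [IsLocalRing S] [Algebra R S] (hS : Function.Surjective (algebraMap R S)) :
    (maximalIdeal R).map (algebraMap R S) = maximalIdeal S := by
  have := IsLocalHom.of_surjective _ hS
  rw [← maximalIdeal_comap (algebraMap R S), Ideal.map_comap_of_surjective _ hS]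

namespace MinimalFreeResolution

variable {R S : Type*} [CommRing R] [CommRing S] [IsLocalRing S] [Algebra R S] {M : Type v}
  [AddCommGroup M] [Module S M] (G : MinimalFreeResolution S M)

/-- The ranks of the resolution `G`, shifted by one and preceded by `0`. -/
abbrev padRank : ℕ → ℕ
  | 0 => 0
  | i + 1 => G.rank i

/-- The differential of the complex `⋯ → G₁ → G₀ → 0`, in which `Gᵢ` has degree `i + 1`. -/
def padD : ∀ i, (Fin (G.padRank (i + 1)) → S) →ₗ[S] (Fin (G.padRank i) → S)
  | 0 => 0
  | i + 1 => G.d i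

theorem padD_comp_padD (i : ℕ) : G.padD i ∘ₗ G.padD (i + 1) = 0 := by
  cases i with
  | zero => exact LinearMap.zero_comp _
  | succ i => exact (G.exact_d i).linearMap_comp_eq_zero

theorem range_padD_le (i : ℕ) : LinearMap.range (G.padD i) ≤ maximalIdeal S • ⊤ := by
  cases i with
  | zero => exact LinearMap.range_zero.trans_le bot_le
  | succ i => exact G.minimal i

/-- The lifts to `R` of the differentials of the resolution `G` over `S = R / (x)`. -/
abbrev DifferentialLift (x : R) : Type _ :=
  ComplexLift x (fun i => Fin (G.padRank i) → R) (Q := fun i => Fin (G.padRank i) → S) fun i =>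
    (G.padD i).restrictScalars R

variable {x : R}

theorem nonempty_differentialLift (hS : Function.Surjective (algebraMap R S))
    (hxS : RingHom.ker (algebraMap R S) = Ideal.span {x}) : Nonempty (G.DifferentialLift x) :=
  ComplexLift.nonempty
    (fun i => LinearMap.ext fun a => (LinearMap.congr_fun (G.padD_comp_padD i) a :))
    (fun i => (Algebra.linearMap R S).compLeft (Fin (G.padRank i))) (fun _ => hS.comp_left)
    fun _ => exact_lsmul_compLeft hxS _

variable [IsLocalRing R]

theorem range_padD_restrictScalars_le (hS : Function.Surjective (algebraMap R S)) (i : ℕ) :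
    LinearMap.range ((G.padD i).restrictScalars R) ≤ maximalIdeal R • ⊤ := by
  rintro _ ⟨a, rfl⟩
  rw [← pow_one (maximalIdeal R), ← mem_map_pow_smul_top_iff S, map_maximalIdeal_of_surjective hS,
    pow_one]
  exact G.range_padD_le i ⟨a, rfl⟩

variable {G} [IsNoetherianRing R] [Module R M] [IsScalarTower R S M] (L : G.DifferentialLift x)
  (hS : Function.Surjective (algebraMap R S)) (hx : x ∈ maximalIdeal R)
  (hreg : IsStrictlyRegular (maximalIdeal R) x R)

/-- The minimal free resolution over `R` of an `S`-module, `S = R / (x)`, which is built from its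
minimal free resolution over `S`. -/
def coneResolution : MinimalFreeResolution R M :=
  have hreg' (i : ℕ) : IsStrictlyRegular (maximalIdeal R) x (Fin (G.padRank i) → R) :=
    .pi fun _ => hreg
  ofLinearEquiv (fun i => finAddPiEquiv R (G.padRank (i + 1)) (G.padRank i)) L.coneD
    (G.aug.restrictScalars R ∘ₗ L.reduction 1 ∘ₗ LinearMap.fst R _ _)
    (G.aug_surjective.comp ((L.reduction_surjective 1).comp Prod.fst_surjective))
    (L.exact_coneD_aug G.exact_aug)
    (fun i => L.exact_coneD (fun j => (hreg' j).isSMulRegular) (G.exact_d i))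
    (L.range_coneD_le hx (G.range_padD_restrictScalars_le hS) hreg')

theorem isZero_homology_linearPart_of_coneResolution {j : ℕ}
    (h : Limits.IsZero ((coneResolution L hS hx hreg).linearPart.homology (j + 1))) :
    Limits.IsZero (G.linearPart.homology (j + 1)) := by
  rw [isZero_homology_linearPart_iff] at h ⊢
  have hcone : IsLinearlyExact (maximalIdeal R) (L.coneD (j + 1)) (L.coneD j) :=
    h.of_ladder_linearEquiv (eA := finAddPiEquiv R _ _) (eB := finAddPiEquiv R _ _)
      (eC := finAddPiEquiv R _ _) (fun _ => LinearEquiv.apply_symm_apply _ _)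
      fun _ => LinearEquiv.apply_symm_apply _ _
  rw [← map_maximalIdeal_of_surjective hS, ← isLinearlyExact_restrictScalars_iff]
  exact L.isLinearlyExact_of_coneD hx (G.range_padD_restrictScalars_le hS)
    (fun _ => .pi fun _ => hreg) hcone

end MinimalFreeResolution

theorem linearityDefect_le_of_isStrictlyRegular {R S : Type*} [CommRing R] [IsLocalRing R]
    [IsNoetherianRing R] [CommRing S] [IsLocalRing S] [Algebra R S] (M : Type v) [AddCommGroup M]
    [Module R M] [Module S M] [IsScalarTower R S M] {x : R}
    (hS : Function.Surjective (algebraMap R S))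
    (hxS : RingHom.ker (algebraMap R S) = Ideal.span {x}) (hx : x ∈ maximalIdeal R)
    (hreg : IsStrictlyRegular (maximalIdeal R) x R) :
    linearityDefect S M ≤ linearityDefect R M := by
  refine iSup_le fun G => ?_
  obtain ⟨L⟩ := G.nonempty_differentialLift hS hxS
  refine le_iSup_of_le (MinimalFreeResolution.coneResolution L hS hx hreg) (iSup₂_le fun i hi => ?_)
  cases i with
  | zero => exact zero_le
  | succ j =>
    refine le_iSup₂_of_le (j + 1) (fun h => hi ?_) le_rfl
    exact MinimalFreeResolution.isZero_homology_linearPart_of_coneResolution L hS hx hreg h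

theorem corollary5p6 {R : Type u} [CommRing R] [IsLocalRing R] [IsNoetherianRing R]
    (hR : IsAbsolutelyKoszul R) (x : R) (hx : x ∈ IsLocalRing.maximalIdeal R)
    (hx2 : x ∉ IsLocalRing.maximalIdeal R ^ 2)
    (hreg : (IsLocalRing.maximalIdeal R).degreeOneClass x hx ∈
      nonZeroDivisors (IsLocalRing.maximalIdeal R).AssociatedGradedRing) :
    ∃ _ : IsLocalRing (R ⧸ Ideal.span {x}), IsAbsolutelyKoszul (R ⧸ Ideal.span {x}) := by
  have : Nontrivial (R ⧸ Ideal.span {x}) := Ideal.Quotient.nontrivial_iff.2 fun h =>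
    (mem_maximalIdeal x).1 hx (Ideal.span_singleton_eq_top.1 h)
  have hloc : IsLocalRing (R ⧸ Ideal.span {x}) :=
    IsLocalRing.of_surjective' (Ideal.Quotient.mk _) Ideal.Quotient.mk_surjective
  refine ⟨hloc, fun M _ _ _ => ?_⟩
  let _ : Module R M := Module.compHom M (algebraMap R (R ⧸ Ideal.span {x}))
  have : IsScalarTower R (R ⧸ Ideal.span {x}) M := IsScalarTower.of_algebraMap_smul fun _ _ => rfl
  have : Module.Finite R M := Module.Finite.trans (R ⧸ Ideal.span {x}) M
  have hle : linearityDefect (R ⧸ Ideal.span {x}) M ≤ linearityDefect R M :=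
    linearityDefect_le_of_isStrictlyRegular M Ideal.Quotient.mk_surjective Ideal.mk_ker hx
      (.of_degreeOneClass_mem_nonZeroDivisors hx hreg)
  exact hle.trans_lt (hR M)
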